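/- Let $\mathcal X$ be a measurable space, let $\mathcal F$ be a nonempty finite set of $M=|\mathcal F|$ measurable features $f:\mathcal X\to\{0,1\}$, and let $\mathcal C$ be the class of $\mathcal F$-decision lists, i.e. of all functions "if $f_1$ then $b_1$, else if $f_2$ then $b_2$, $\dots$, else $b$" with $f_i\in\mathcal F$ and $b_i,b\in\{0,1\}$. Write $\mathrm{VC}(\mathcal C)$ for its VC dimension and $\log$ for the natural logarithm. For $\eta>0$, the algorithm $\mathsf{DP\text{-}GreedyCover}_\eta$ receives a sample $S=((x_i,\sigma_i))_{i=1}^n\in(\mathcal X\times\{0,1\})^n$. It starts with $S_1=S$ and $\mathcal F_1=\mathcal F\cup\{T\}$, where $T$ is the constant true feature. In round $j=1,\dots,|\mathcal F_1|$ it draws a pair $(f_j,b_j)\in\mathcal F_j\times\{0,1\}$ with probability proportional to $\exp(\eta\, q(S_j,(f_j,b_j))/2)$, where $q(S_j,(f,b))=-|\{(x,\sigma)\in S_j: f(x)=1,\ \sigma=1-b\}|$ (examples counted with multiplicity), and sets $S_{j+1}=\{(x,\sigma)\in S_j: f_j(x)=0\}$ and $\mathcal F_{j+1}=\mathcal F_j\setminus\{f_j\}$.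 It outputs the decision list $[(f_1,b_1),(f_2,b_2),\dots]$. Let $\delta\in(0,1)$ and $0<\varepsilon\le 4\log(1/\delta)+3$ (in particular, any $0<\varepsilon\le3$). Then there is $\eta>0$, depending only on $\varepsilon$ and $\delta$, such that the following hold for all such $\mathcal X$ and $\mathcal F$. 1. (Privacy) For every $n$, $\mathsf{DP\text{-}GreedyCover}_\eta$ is $(\varepsilon,\delta)$-differentially private: $\Pr[L(S)\in R]\le e^{\varepsilon}\Pr[L(S')\in R]+\delta$ for all $S,S'\in(\mathcal X\times\{0,1\})^n$ that differ in a single example and all sets $R$ of outputs. 2. (Accuracy) For all $\alpha,\beta\in(0,1)$ and all $$n\ \ge\ \max\left(\frac{64}{\alpha}\Big(\mathrm{VC}(\mathcal C)\log\frac{64}{\alpha}+\log\frac{16}{\beta}\Big),\ \frac{8M\log\big(\frac{2M}{\sqrt\beta}\big)\big(2\log\frac1\delta+\frac32\big)}{\alpha\varepsilon}\right),$$ $\mathsf{DP\text{-}GreedyCover}_\eta$ is an $(\alpha,\beta)$-PAC learner for $\mathcal C$ on samples of size $n$: for every probability distribution $D$ on $\mathcal X$ and every $c\in\mathcal C$,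 with probability at least $1-\beta$ over $x_1,\dots,x_n$ i.i.d. from $D$ and the coins of the algorithm, the output $h$ on $((x_i,c(x_i)))_{i=1}^n$ satisfies $\Pr_{x\sim D}[c(x)\ne h(x)]\le\alpha$. 3. (Running time) Count unit cost for each feature evaluation, Boolean, list or real arithmetic operation, exponential, and draw of a uniform random number. Then the algorithm always runs in time polynomial in $M$. Precisely, there is a polynomial $p$, independent of all parameters, such that it takes at most $p(M)(n+1)$ steps on every sample of every size $n$; and for all $\alpha,\beta\in(0,1)$ there is a polynomial $q$, depending only on $\alpha,\beta,\varepsilon,\delta$, such that for $n$ equal to the bound in 2 rounded up it takes at most $q(M)$ steps. -/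

import Mathlib

open MeasureTheory ProbabilityTheory
open scoped ENNReal

universe u v

namespace DecisionListLearning

/-! ### Decision lists -/

/-- A rule `(f, b)`: if the feature `f` fires, answer `b`. -/
abbrev Rule (X : Type u) : Type u := (X → Bool) × Bool

/-- The Boolean function computed by the rules `L` followed by "else `d`". -/
def evalList {X : Type u} : List (Rule X) → Bool → X → Bool
  | [], d, _ => d
  | r :: L, d, x => if r.1 x = true then r.2 else evalList L d x

/-- The concept class of `F`-decision lists (of arbitrary length). -/
def decisionLists {X : Type u} (F : Finset (X → Bool)) : Set (X → Bool) :=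
  {c | ∃ (L : List (Rule X)) (d : Bool), (∀ r ∈ L, r.1 ∈ F) ∧ c = evalList L d}

/-! ### VC dimension -/

/-- `C` shatters `A`: every labelling of `A` is realized by some concept of `C`. -/
def Shatters {X : Type u} (C : Set (X → Bool)) (A : Finset X) : Prop :=
  ∀ g : X → Bool, ∃ c ∈ C, ∀ x ∈ A, c x = g x

/-- The VC dimension: the supremum of the sizes of the finite shattered sets. -/
noncomputable def vcDim {X : Type u} (C : Set (X → Bool)) : ℕ∞ :=
  ⨆ (A : Finset X) (_ : Shatters C A), (A.card : ℕ∞)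

theorem evalList_congr {X : Type u} {F : Finset (X → Bool)} {x y : X}
    (h : ∀ f ∈ F, f x = f y) (L : List (Rule X)) (d : Bool) (hL : ∀ r ∈ L, r.1 ∈ F) :
    evalList L d x = evalList L d y := by
  induction L with
  | nil => rfl
  | cons r L ih =>
    have h1 := h r.1 (hL r (by simp))
    have h2 := ih (fun s hs => hL s (by simp [hs]))
    simp only [evalList, h1, h2]

/-- The class of decision lists over finitely many features has finite VC dimension, so that
`(vcDim (decisionLists F)).toNat` is its VC dimension. -/
theorem vcDim_decisionLists_ne_top {X : Type u} (F : Finset (X → Bool)) :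
    vcDim (decisionLists F) ≠ ⊤ := by
  classical
  have key : vcDim (decisionLists F) ≤ ((Fintype.card (F → Bool) : ℕ) : ℕ∞) := by
    refine iSup₂_le fun A hA => ?_
    have hinj : Set.InjOn (fun x : X => fun f : F => f.1 x) (A : Set X) := by
      intro x hx y hy hxy
      by_contra hne
      obtain ⟨c, ⟨L, d, hL, rfl⟩, hc⟩ := hA (fun z => decide (z = x))
      have h1 := hc x hx
      have h2 := hc y hy
      have h3 := evalList_congr (F := F) (x := x) (y := y)
        (fun f hf => congrFun hxy ⟨f, hf⟩) L d hL
      rw [h1, h2] at h3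
      simp only [decide_true] at h3
      exact hne (of_decide_eq_true h3.symm).symm
    have hcard := Finset.card_le_card_of_injOn (t := Finset.univ)
      (fun x : X => fun f : F => f.1 x) (fun _ _ => Finset.mem_coe.2 (Finset.mem_univ _)) hinj
    rw [Finset.card_univ] at hcard
    exact_mod_cast hcard
  exact ne_top_of_le_ne_top (ENat.natCast_ne_top _) key

/-! ### Differential privacy and PAC learning -/

/-- Two datasets of the same size are neighbouring if they differ in (at most) one example. -/
def Neighbouring {Z : Type u} {n : ℕ} (S S' : Fin n → Z) : Prop :=
  ∃ i, ∀ j, j ≠ i → S j = S' j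

/-- `(ε, δ)`-differential privacy of a randomized algorithm on datasets of size `n`. -/
def IsDP {Z : Type u} {H : Type v} {n : ℕ} (ε δ : ℝ) (L : (Fin n → Z) → PMF H) : Prop :=
  ∀ S S' : Fin n → Z, Neighbouring S S' → ∀ R : Set H,
    (L S).toOuterMeasure R ≤
      ENNReal.ofReal (Real.exp ε) * (L S').toOuterMeasure R + ENNReal.ofReal δ

/-- `err_D(c, h) = Pr_{x ∼ D}[c x ≠ h x]`. -/
noncomputable def err {X : Type u} [MeasurableSpace X] (D : Measure X) (c h : X → Bool) : ℝ≥0∞ :=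
  D {x | c x ≠ h x}

/-- `L` is an `(α, β)`-PAC learner for `C` on samples of size `n`: for every distribution `D` and
every target `c ∈ C`, with probability at least `1 - β` over the i.i.d. sample (the integral) and
the coins of `L` (the inner probability), the output hypothesis has error at most `α`. -/
def IsPACLearner {X : Type u} [MeasurableSpace X] {H : Type v} {n : ℕ} (C : Set (X → Bool))
    (α β : ℝ) (eval : H → X → Bool) (L : (Fin n → X × Bool) → PMF H) : Prop :=
  ∀ (D : Measure X) [IsProbabilityMeasure D], ∀ c ∈ C,
    1 - ENNReal.ofReal β ≤
      ∫⁻ xs : Fin n → X,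
        (L fun i => (xs i, c (xs i))).toOuterMeasure {h | err D c (eval h) ≤ ENNReal.ofReal α}
        ∂(Measure.pi fun _ : Fin n => D)

/-! ### Step counting

A unit-cost (real-RAM) model: one step for evaluating a feature on an example, for a Boolean or
arithmetic operation, for an evaluation of `exp`, for a list operation at the head of a list, and
for drawing a uniform random number. -/

/-- The result of a deterministic computation together with the number of steps it took. -/
structure Timed (A : Type u) where
  val : A
  steps : ℕ

/-- One elementary operation with result `a`. -/
def Timed.op {A : Type u} (a : A) : Timed A := ⟨a, 1⟩

/-- Sequential execution; the step counts add up. -/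
def Timed.bind {A : Type u} {B : Type v} (m : Timed A) (k : A → Timed B) : Timed B :=
  ⟨(k m.val).val, m.steps + (k m.val).steps⟩

/-! ### The algorithm `DP-GreedyCover` -/

/-- The exponential mechanism for the score `q` with parameter `η`: it draws `h` with probability
proportional to `exp (η * q h / 2)`. -/
noncomputable def expMech {H : Type v} [Fintype H] [Nonempty H] (η : ℝ) (q : H → ℝ) : PMF H :=
  PMF.normalize (fun h => ENNReal.ofReal (Real.exp (η * q h / 2)))
    (by
      rw [tsum_fintype]
      obtain ⟨h⟩ := ‹Nonempty H›
      intro h0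
      rw [Finset.sum_eq_zero_iff] at h0
      have := h0 h (Finset.mem_univ h)
      rw [ENNReal.ofReal_eq_zero] at this
      exact absurd this (not_le.2 (Real.exp_pos _)))
    (by
      rw [tsum_fintype]
      exact ENNReal.sum_ne_top.2 fun _ _ => ENNReal.ofReal_ne_top)

/-- The number of steps charged for running the exponential mechanism on `k` candidates whose
scores are known, by inversion of the cumulative distribution: one uniform draw, one scaling of
it by the total weight, and for each candidate one look-up of its score, one multiplication by
`η / 2`, one exponential, one addition to the running total and one comparison with the drawn
threshold. -/
def expMechSteps (k : ℕ) : ℕ := 5 * k + 2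

/-- The numbers of negative and of positive examples of `S` that `f` labels as `1`. -/
def tally {X : Type u} (f : X → Bool) : List (X × Bool) → Timed (ℕ × ℕ)
  | [] => Timed.op (0, 0)
  | z :: S =>
    (tally f S).bind fun m =>
    (Timed.op (f z.1)).bind fun v =>
    (Timed.op (v && !z.2)).bind fun neg =>
    (Timed.op (v && z.2)).bind fun pos =>
    (Timed.op (if neg then m.1 + 1 else m.1)).bind fun a =>
    (Timed.op (if pos then m.2 + 1 else m.2)).bind fun b =>
    Timed.op (a, b)

/-- The tallies of all features in the list. -/
def tallies {X : Type u} : List (X → Bool) → List (X × Bool) → Timed (List (ℕ × ℕ))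
  | [], _ => Timed.op []
  | f :: Fs, S =>
    (tally f S).bind fun m =>
    (tallies Fs S).bind fun t =>
    Timed.op (m :: t)

/-- The number of examples of label `1 - b` among the tallied ones, i.e. the number of errors that
the rule `(f, b)` makes on the examples it covers. -/
def errors (m : ℕ × ℕ) (b : Bool) : ℕ := if b then m.1 else m.2

/-- The examples of `S` on which `f` evaluates to `0`. -/
def uncovered {X : Type u} (f : X → Bool) : List (X × Bool) → Timed (List (X × Bool))
  | [] => Timed.op []
  | z :: S =>
    (uncovered f S).bind fun S' =>
    (Timed.op (f z.1)).bind fun v =>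
    Timed.op (if v then S' else z :: S')

/-- The list without its entry at position `i`. -/
def removeAt {A : Type u} : ℕ → List A → Timed (List A)
  | _, [] => Timed.op []
  | 0, _ :: l => Timed.op l
  | i + 1, a :: l => (removeAt i l).bind fun l' => Timed.op (a :: l')

/-- `k` rounds of the greedy cover loop with remaining features `Fs` and remaining sample `S`; the
result is the list of the selected rules and the number of steps. In a round, a pair of (a position
of) a feature and a label is drawn by the exponential mechanism with parameter `η` for the score
`-#{examples of label 1 - b on which f is 1}`, the covered examples are removed from the sample and
the selected feature from the features. -/
noncomputable def greedyCover {X : Type u} (η : ℝ) :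
    ℕ → List (X → Bool) → List (X × Bool) → PMF (List (Rule X) × ℕ)
  | 0, _, _ => PMF.pure ([], 1)
  | _ + 1, [], _ => PMF.pure ([], 1)
  | k + 1, f₀ :: Fs₀, S =>
    let Fs := f₀ :: Fs₀
    let t := tallies Fs S
    (expMech η fun p : Fin Fs.length × Bool =>
        -(errors (t.val.getD p.1 (0, 0)) p.2 : ℝ)).bind fun p =>
      let S' := uncovered (Fs.get p.1) S
      let Fs' := removeAt p.1 Fs
      (greedyCover η k Fs'.val S'.val).map fun o =>
        ((Fs.get p.1, p.2) :: o.1,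
          t.steps + expMechSteps (2 * Fs.length) + S'.steps + Fs'.steps + 1 + o.2)

open Classical in
/-- The feature set `F` together with the constant true feature, as a list. -/
noncomputable def withTrue {X : Type u} (F : Finset (X → Bool)) : List (X → Bool) :=
  (insert (fun _ => true) F).toList

/-- `DP-GreedyCover` with its step count: the loop is run on `F` together with the constant true
feature until all features are used. -/
noncomputable def timedDPGreedyCover {X : Type u} (η : ℝ) (F : Finset (X → Bool)) {n : ℕ}
    (S : Fin n → X × Bool) : PMF (List (Rule X) × ℕ) :=
  greedyCover η (withTrue F).length (withTrue F) (List.ofFn S)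

/-- `DP-GreedyCover`: the distribution of the released list of rules. -/
noncomputable def dpGreedyCover {X : Type u} (η : ℝ) (F : Finset (X → Bool)) {n : ℕ}
    (S : Fin n → X × Bool) : PMF (List (Rule X)) :=
  (timedDPGreedyCover η F S).map Prod.fst

/-- The hypothesis described by a released list. Such a list contains a rule for the constant true
feature, so that the default value is never used. -/
def hypothesis {X : Type u} (h : List (Rule X)) : X → Bool := evalList h false

/-- On the sample `S`, `DP-GreedyCover` takes at most `t` steps, whatever its random choices. -/
def RunsWithin {X : Type u} (η : ℝ) (F : Finset (X → Bool)) {n : ℕ} (S : Fin n → X × Bool)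
    (t : ℕ) : Prop :=
  ∀ o ∈ (timedDPGreedyCover η F S).support, o.2 ≤ t

/-- The sample complexity bound, for a class of VC dimension `d` and `M` features. -/
noncomputable def sampleBound (d M : ℕ) (α β ε δ : ℝ) : ℝ :=
  max (64 / α * (d * Real.log (64 / α) + Real.log (16 / β)))
    (8 * M * Real.log (2 * M / Real.sqrt β) * (2 * Real.log (1 / δ) + 3 / 2) / (α * ε))

end DecisionListLearning

namespace DecisionListLearning

/-! Privacy comes from comparing a sample with and without one example `z`, at a cost that does not
grow with the number of rounds. Deleting `z` costs a factor `exp (η/2)` at most once, when a rule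
covering `z` is drawn; afterwards the two runs coincide (`outProb_le_exp_mul_outProb_cons`). Adding
`z` costs a factor at most `exp (c b)` in each round, where `c = exp (η/2) - 1` and `b` is the
probability of drawing a rule that mislabels `z`. Drawing such a rule ends the comparison, so a run
reaches accumulated `b` above `s` with probability at most `∏ (1 - b) ≤ exp (-s)`
(`outProb_cons_le`). With `s = log (1/δ)` this gives `isDP_dpGreedyCover`.

Accuracy is a union bound over the at most `2^(M+1) (M+1)!` runs, without uniform convergence. On a
sample labelled by a decision list some remaining rule is always error-free, so the normalizer is at
least `1` and a run has probability at most `exp (-η/2)` to the number of its sample errors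
(`exists_runs`). For a hypothesis of error at least `α` the i.i.d. average of this is at most `exp
(-α (1 - exp (-η/2)) n)`.

The loop is quadratic in `M` and linear in `n`; since the VC dimension is at most `M + 1`, the
prescribed `n` is itself polynomial in `M`. -/

variable {X : Type u}

/-! ### Values and step counts of the subroutines -/

/-- The number of examples of `S` that the rule `r` covers and mislabels. -/
def mistakes (r : Rule X) (S : List (X × Bool)) : ℕ :=
  S.countP fun z => r.1 z.1 && (z.2 != r.2)

theorem errors_tally (f : X → Bool) (b : Bool) (S : List (X × Bool)) :
    errors (tally f S).val b = mistakes (f, b) S := by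
  induction S with
  | nil => cases b <;> rfl
  | cons z S ih =>
    unfold mistakes at ih ⊢
    rw [List.countP_cons, ← ih]
    obtain ⟨x, σ⟩ := z
    cases b <;> cases σ <;> cases h : f x <;>
      simp [tally, Timed.bind, Timed.op, errors, h]

theorem steps_tally (f : X → Bool) (S : List (X × Bool)) :
    (tally f S).steps = 6 * S.length + 1 := by
  induction S with
  | nil => rfl
  | cons z S ih => simp only [tally, Timed.bind, Timed.op, ih, List.length_cons]; ring

theorem val_tallies (Fs : List (X → Bool)) (S : List (X × Bool)) :
    (tallies Fs S).val = Fs.map fun f => (tally f S).val := by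
  induction Fs with
  | nil => rfl
  | cons f Fs ih => simp [tallies, Timed.bind, Timed.op, ih]

theorem steps_tallies (Fs : List (X → Bool)) (S : List (X × Bool)) :
    (tallies Fs S).steps = Fs.length * (6 * S.length + 2) + 1 := by
  induction Fs with
  | nil => simp [tallies, Timed.op]
  | cons f Fs ih =>
    simp only [tallies, Timed.bind, Timed.op, ih, steps_tally, List.length_cons]; ring

theorem val_uncovered (f : X → Bool) (S : List (X × Bool)) :
    (uncovered f S).val = S.filter fun z => !f z.1 := by
  induction S with
  | nil => rfl
  | cons z S ih =>
    simp only [uncovered, Timed.bind, Timed.op, ih, List.filter_cons]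
    cases f z.1 <;> simp

theorem steps_uncovered (f : X → Bool) (S : List (X × Bool)) :
    (uncovered f S).steps = 2 * S.length + 1 := by
  induction S with
  | nil => rfl
  | cons z S ih => simp only [uncovered, Timed.bind, Timed.op, ih, List.length_cons]; ring

theorem val_removeAt {A : Type v} (i : ℕ) (l : List A) :
    (removeAt i l).val = l.eraseIdx i := by
  induction l generalizing i with
  | nil => cases i <;> rfl
  | cons a l ih => cases i <;> simp [removeAt, Timed.bind, Timed.op, ih]

theorem steps_removeAt_le {A : Type v} (i : ℕ) (l : List A) :
    (removeAt i l).steps ≤ l.length + 1 := by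
  induction l generalizing i with
  | nil => cases i <;> simp [removeAt, Timed.op]
  | cons a l ih =>
    cases i with
    | zero => simp [removeAt, Timed.op]
    | succ i => simpa [removeAt, Timed.bind, Timed.op] using ih i

theorem errors_tallies_getD (Fs : List (X → Bool)) (S : List (X × Bool)) (i : Fin Fs.length)
    (b : Bool) :
    errors ((tallies Fs S).val.getD i (0, 0)) b = mistakes (Fs.get i, b) S := by
  rw [val_tallies, List.getD_eq_getElem _ _ (by simp), List.getElem_map, errors_tally]
  rfl

/-! ### Running time -/

theorem steps_greedyCover_le (η : ℝ) (m n k : ℕ) (Fs : List (X → Bool)) (S : List (X × Bool))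
    (hF : Fs.length ≤ m) (hS : S.length ≤ n) :
    ∀ o ∈ (greedyCover η k Fs S).support, o.2 ≤ 1 + k * (13 * (m + 1) * (n + 1)) := by
  induction k generalizing Fs S with
  | zero => intro o ho; cases Fs <;> simp_all [greedyCover]
  | succ k ih =>
    cases Fs with
    | nil => intro o ho; simp_all [greedyCover]
    | cons f Fs =>
      intro o ho
      simp only [greedyCover, PMF.mem_support_bind_iff, PMF.mem_support_map_iff] at ho
      obtain ⟨p, -, o', ho', rfl⟩ := ho
      have h1 := ih _ _ (by rw [val_removeAt]; exact (List.length_eraseIdx_le ..).trans hF)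
        (by rw [val_uncovered]; exact (List.length_filter_le ..).trans hS) o' ho'
      have h2 := steps_removeAt_le p.1 (f :: Fs)
      simp only [steps_tallies, steps_uncovered, expMechSteps]
      have h3 : (f :: Fs).length * S.length ≤ m * n := Nat.mul_le_mul hF hS
      -- With `b ≤ a + 1` a round costs at most `6as + 13a + 2s + 6`, hence the constant 13. The
      -- product `a * s` is bounded separately, so that `omega` can treat it as an atom.
      have key : ∀ a b c s : ℕ, a ≤ m → s ≤ n → a * s ≤ m * n → b ≤ a + 1 →
          c ≤ 1 + k * (13 * (m + 1) * (n + 1)) →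
          a * (6 * s + 2) + 1 + (5 * (2 * a) + 2) + (2 * s + 1) + b + 1 + c ≤
            1 + (k + 1) * (13 * (m + 1) * (n + 1)) := by
        intro a b c s ha hs has hb hc
        have e1 : a * (6 * s + 2) = 6 * (a * s) + 2 * a := by ring
        have e2 : (k + 1) * (13 * (m + 1) * (n + 1)) =
          k * (13 * (m + 1) * (n + 1)) + 13 * (m * n) + 13 * m + 13 * n + 13 := by ring
        rw [e1, e2]
        omega
      exact key _ _ _ _ hF hS h3 h2 h1

theorem length_withTrue_le (F : Finset (X → Bool)) : (withTrue F).length ≤ F.card + 1 := by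
  classical
  rw [withTrue, Finset.length_toList]
  exact Finset.card_insert_le _ _

theorem runsWithin_of_le (η : ℝ) (F : Finset (X → Bool)) {n t : ℕ} (S : Fin n → X × Bool)
    (ht : (1 + 13 * (F.card + 1) * (F.card + 2)) * (n + 1) ≤ t) : RunsWithin η F S t := by
  intro o ho
  have h := steps_greedyCover_le η (F.card + 1) n _ _ (List.ofFn S) (length_withTrue_le F)
    (by simp) o ho
  refine h.trans (le_trans ?_ ht)
  have := Nat.mul_le_mul_right (13 * (F.card + 1 + 1) * (n + 1)) (length_withTrue_le F)
  nlinarith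

/-! ### The VC dimension of decision lists -/

/-- If signed weights `a` with the signs of the labels computed by a decision list are orthogonal
to all features of the list and to the constant function, then they vanish. -/
theorem eq_zero_of_evalList_eq_sign {A : Finset X} {a : X → ℝ} {d : Bool} {L : List (Rule X)}
    (hL : ∀ r ∈ L, ∑ x ∈ A, a x * (if r.1 x = true then 1 else 0) = 0)
    (h1 : ∑ x ∈ A, a x = 0) (h : ∀ x ∈ A, evalList L d x = decide (0 < a x)) :
    ∀ x ∈ A, a x = 0 := by
  classical
  have mono : ∀ (B : Finset X) (b : Bool), (∀ x ∈ B, a x ≠ 0 → b = decide (0 < a x)) →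
      ∑ x ∈ B, a x = 0 → ∀ x ∈ B, a x = 0 := by
    intro B b hb hs
    cases b with
    | true =>
      refine (Finset.sum_eq_zero_iff_of_nonneg fun x hx => ?_).1 hs
      by_contra hc
      have := hb x hx (by linarith)
      simp at this
      linarith
    | false =>
      refine (Finset.sum_eq_zero_iff_of_nonpos fun x hx => ?_).1 hs
      by_contra hc
      have := hb x hx (by linarith)
      simp at this
      linarith
  -- Labels are constant on the points covered by the first rule, so there `a` has one sign and sum
  -- zero, hence vanishes. The other points see only the tail of the list. Demanding correct labels
  -- only where `a x ≠ 0` lets the induction forget the covered points.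
  have main : ∀ (L : List (Rule X)),
      (∀ r ∈ L, ∑ x ∈ A, a x * (if r.1 x = true then 1 else 0) = 0) →
      (∀ x ∈ A, a x ≠ 0 → evalList L d x = decide (0 < a x)) → ∀ x ∈ A, a x = 0 := by
    intro L
    induction L with
    | nil => intro _ h; exact mono A d h h1
    | cons r L ih =>
      intro hL h
      have hr := hL r (by simp)
      have h0 : ∀ x ∈ A.filter (fun x => r.1 x = true), a x = 0 := by
        refine mono _ r.2 (fun x hx hx0 => ?_) ?_
        · rw [Finset.mem_filter] at hx
          simpa [evalList, hx.2] using h x hx.1 hx0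
        · simpa [Finset.sum_filter] using hr
      refine ih (fun s hs => hL s (by simp [hs])) fun x hx hx0 => ?_
      have hrx : r.1 x ≠ true := fun hc => hx0 (h0 x (by simp [hx, hc]))
      simpa [evalList, hrx] using h x hx hx0
  exact main L hL fun x hx _ => h x hx

/-- More than `M + 1` points have linearly dependent vectors of feature values extended by a
constant coordinate. The sign pattern of a dependency is a labelling that no decision list realizes.
-/
theorem vcDim_decisionLists_le (F : Finset (X → Bool)) :
    vcDim (decisionLists F) ≤ ((F.card + 1 : ℕ) : ℕ∞) := by
  classical
  refine iSup₂_le fun A hA => ?_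
  by_contra! hlt
  have hlt' : F.card + 1 < A.card := by exact_mod_cast hlt
  let φ : A → (Option F → ℝ) := fun x o =>
    o.elim 1 fun f => if f.1 x = true then 1 else 0
  have hdep : ¬ LinearIndependent ℝ φ := fun hli => by
    have := hli.fintype_card_le_finrank
    rw [Module.finrank_fintype_fun_eq_card] at this
    simp at this
    omega
  obtain ⟨a, ha, i, hi⟩ := Fintype.not_linearIndependent_iff.1 hdep
  let a' : X → ℝ := fun x => if h : x ∈ A then a ⟨x, h⟩ else 0
  have hsum : ∀ g : X → ℝ, ∑ x ∈ A, a' x * g x = ∑ x : A, a x * g x := by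
    intro g
    rw [← Finset.sum_coe_sort A]
    exact Finset.sum_congr rfl fun x _ => by simp [a']
  obtain ⟨c, ⟨L, d, hL, rfl⟩, hc⟩ := hA fun x => decide (0 < a' x)
  refine hi ?_
  have := eq_zero_of_evalList_eq_sign (A := A) (a := a') (L := L) (d := d) ?_ ?_ hc i i.2
  · simpa [a'] using this
  · intro r hr
    rw [hsum]
    have := congrFun ha (some ⟨r.1, hL r hr⟩)
    simpa [φ, Finset.sum_apply] using this
  · have h1 := hsum fun _ => 1
    have := congrFun ha none
    simp only [mul_one] at h1
    rw [h1]
    simpa [φ, Finset.sum_apply] using this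

theorem toNat_vcDim_decisionLists_le (F : Finset (X → Bool)) :
    (vcDim (decisionLists F)).toNat ≤ F.card + 1 :=
  ENat.toNat_le_of_le_natCast (vcDim_decisionLists_le F)

/-- The sample bound grows at most quadratically in the number of features. -/
theorem exists_ceil_sampleBound_le (α β ε δ : ℝ) (hα : 0 < α) (hα1 : α < 1) (hβ : 0 < β)
    (hβ1 : β < 1) (hε : 0 < ε) (hδ : 0 < δ) (hδ1 : δ < 1) :
    ∃ K : ℕ, ∀ d M : ℕ, d ≤ M + 1 → ⌈sampleBound d M α β ε δ⌉₊ ≤ K * (M + 1) ^ 2 := by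
  have l1 : 0 ≤ Real.log (64 / α) := Real.log_nonneg (by rw [le_div_iff₀ hα]; linarith)
  have l2 : 0 ≤ Real.log (16 / β) := Real.log_nonneg (by rw [le_div_iff₀ hβ]; linarith)
  have l3 : 0 ≤ Real.log (1 / δ) := Real.log_nonneg (by rw [le_div_iff₀ hδ]; linarith)
  have hsq : 0 < Real.sqrt β := Real.sqrt_pos.2 hβ
  set K₁ : ℝ := 64 / α * (Real.log (64 / α) + Real.log (16 / β)) with hK₁
  set K₂ : ℝ := 16 / Real.sqrt β * (2 * Real.log (1 / δ) + 3 / 2) / (α * ε) with hK₂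
  have hK₁0 : 0 ≤ K₁ := by positivity
  have hK₂0 : 0 ≤ K₂ := by positivity
  refine ⟨⌈K₁ + K₂⌉₊, fun d M hd => Nat.ceil_le.2 ?_⟩
  have hd' : (d : ℝ) ≤ M + 1 := by exact_mod_cast hd
  have hM : (0 : ℝ) ≤ M := M.cast_nonneg
  have hK : K₁ + K₂ ≤ (⌈K₁ + K₂⌉₊ : ℝ) := Nat.le_ceil _
  have hsqM : (0 : ℝ) ≤ ((M : ℝ) + 1) ^ 2 := by positivity
  push_cast
  refine le_trans ?_ (mul_le_mul_of_nonneg_right hK hsqM)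
  rw [sampleBound, add_mul]
  refine max_le ?_ ?_
  · have h1 : (d : ℝ) * Real.log (64 / α) + Real.log (16 / β) ≤
        (Real.log (64 / α) + Real.log (16 / β)) * ((M : ℝ) + 1) ^ 2 := by
      have : (d : ℝ) ≤ ((M : ℝ) + 1) ^ 2 := by nlinarith
      have : (1 : ℝ) ≤ ((M : ℝ) + 1) ^ 2 := by nlinarith
      nlinarith
    have h2 := mul_le_mul_of_nonneg_left h1 (show 0 ≤ 64 / α by positivity)
    have h3 : 0 ≤ K₂ * ((M : ℝ) + 1) ^ 2 := by positivity
    rw [hK₁]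
    linarith
  -- The crude `log y ≤ y` turns `M log M` into `M ^ 2`, which is enough for a polynomial bound.
  · have h1 : Real.log (2 * M / Real.sqrt β) ≤ 2 * M / Real.sqrt β :=
      Real.log_le_self (by positivity)
    have h2 : 8 * M * Real.log (2 * M / Real.sqrt β) * (2 * Real.log (1 / δ) + 3 / 2) / (α * ε) ≤
        8 * M * (2 * M / Real.sqrt β) * (2 * Real.log (1 / δ) + 3 / 2) / (α * ε) := by
      gcongr
    have h3 : 8 * M * (2 * M / Real.sqrt β) * (2 * Real.log (1 / δ) + 3 / 2) / (α * ε) =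
        K₂ * (M : ℝ) ^ 2 := by
      rw [hK₂]; ring
    have h4 : K₂ * (M : ℝ) ^ 2 ≤ K₂ * ((M : ℝ) + 1) ^ 2 := by gcongr; linarith
    have h5 : 0 ≤ K₁ * ((M : ℝ) + 1) ^ 2 := by positivity
    linarith

/-! ### The output distribution -/

/-- The unnormalized probability with which the exponential mechanism draws the rule `r`. -/
noncomputable def weight (η : ℝ) (S : List (X × Bool)) (r : Rule X) : ℝ :=
  Real.exp (-(η / 2 * mistakes r S))

theorem weight_pos (η : ℝ) (S : List (X × Bool)) (r : Rule X) : 0 < weight η S r :=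
  Real.exp_pos _

/-- The total weight of the rules with features in `Fs`. -/
noncomputable def totalWeight (η : ℝ) (Fs : List (X → Bool)) (S : List (X × Bool)) : ℝ :=
  ∑ p : Fin Fs.length × Bool, weight η S (Fs.get p.1, p.2)

theorem totalWeight_pos (η : ℝ) {Fs : List (X → Bool)} (hF : Fs ≠ []) (S : List (X × Bool)) :
    0 < totalWeight η Fs S := by
  have : 0 < Fs.length := List.length_pos_iff.2 hF
  exact Finset.sum_pos (fun p _ => weight_pos _ _ _) ⟨(⟨0, this⟩, true), Finset.mem_univ _⟩

/-- The probability that `k` rounds of the greedy cover loop release a list of rules in `R`. -/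
noncomputable def outProb (η : ℝ) (k : ℕ) (Fs : List (X → Bool)) (S : List (X × Bool))
    (R : Set (List (Rule X))) : ℝ :=
  (((greedyCover η k Fs S).map Prod.fst).toOuterMeasure R).toReal

theorem toOuterMeasure_le_one {A : Type v} (p : PMF A) (R : Set A) : p.toOuterMeasure R ≤ 1 := by
  classical
  rw [PMF.toOuterMeasure_apply, ← p.tsum_coe]
  exact ENNReal.tsum_le_tsum fun a => Set.indicator_le_self _ _ _

theorem ofReal_outProb (η : ℝ) (k : ℕ) (Fs : List (X → Bool)) (S : List (X × Bool))
    (R : Set (List (Rule X))) :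
    ENNReal.ofReal (outProb η k Fs S R) =
      ((greedyCover η k Fs S).map Prod.fst).toOuterMeasure R :=
  ENNReal.ofReal_toReal (ne_top_of_le_ne_top ENNReal.one_ne_top (toOuterMeasure_le_one _ _))

theorem outProb_nonneg (η : ℝ) (k : ℕ) (Fs : List (X → Bool)) (S : List (X × Bool))
    (R : Set (List (Rule X))) : 0 ≤ outProb η k Fs S R := ENNReal.toReal_nonneg

theorem outProb_le_one (η : ℝ) (k : ℕ) (Fs : List (X → Bool)) (S : List (X × Bool))
    (R : Set (List (Rule X))) : outProb η k Fs S R ≤ 1 :=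
  ENNReal.toReal_le_of_le_ofReal zero_le_one (by
    rw [ENNReal.ofReal_one]; exact toOuterMeasure_le_one _ R)

theorem outProb_zero (η : ℝ) (Fs : List (X → Bool)) (S S' : List (X × Bool))
    (R : Set (List (Rule X))) : outProb η 0 Fs S R = outProb η 0 Fs S' R := by
  simp [outProb, greedyCover]

theorem outProb_nil (η : ℝ) (k : ℕ) (S S' : List (X × Bool))
    (R : Set (List (Rule X))) : outProb η k [] S R = outProb η k [] S' R := by
  cases k <;> simp [outProb, greedyCover]

theorem expMech_apply_toReal {H : Type v} [Fintype H] [Nonempty H] (η : ℝ) (q : H → ℝ) (h : H) :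
    (expMech η q h).toReal = Real.exp (η * q h / 2) / ∑ h', Real.exp (η * q h' / 2) := by
  rw [expMech, PMF.normalize_apply, tsum_fintype, ENNReal.toReal_mul, ENNReal.toReal_inv,
    ENNReal.toReal_sum fun _ _ => ENNReal.ofReal_ne_top]
  simp only [ENNReal.toReal_ofReal (Real.exp_pos _).le]
  exact (div_eq_mul_inv _ _).symm

/-- Conditioning on the first drawn rule. The privacy and accuracy arguments unfold the loop only
through this recursion. -/
theorem outProb_succ (η : ℝ) (k : ℕ) {Fs : List (X → Bool)} (hF : Fs ≠ []) (S : List (X × Bool))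
    (R : Set (List (Rule X))) :
    outProb η (k + 1) Fs S R = ∑ p : Fin Fs.length × Bool,
      weight η S (Fs.get p.1, p.2) / totalWeight η Fs S *
        outProb η k (Fs.eraseIdx p.1) (S.filter fun z => !Fs.get p.1 z.1)
          {L | (Fs.get p.1, p.2) :: L ∈ R} := by
  obtain ⟨f, Fs, rfl⟩ := List.exists_cons_of_ne_nil hF
  have hw : ∀ p : Fin (f :: Fs).length × Bool,
      η * -(errors ((tallies (f :: Fs) S).val.getD p.1 (0, 0)) p.2 : ℝ) / 2 =
        -(η / 2 * mistakes ((f :: Fs).get p.1, p.2) S) := by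
    intro p
    rw [errors_tallies_getD]
    ring
  rw [outProb, greedyCover, PMF.map_bind, PMF.toOuterMeasure_bind_apply, tsum_fintype,
    ENNReal.toReal_sum]
  · refine Finset.sum_congr rfl fun p _ => ?_
    rw [ENNReal.toReal_mul, expMech_apply_toReal]
    congr 1
    · simp only [hw, weight, totalWeight]
    · rw [outProb, PMF.map_comp, PMF.toOuterMeasure_map_apply, PMF.toOuterMeasure_map_apply,
        val_removeAt, val_uncovered]
      rfl
  · intro p _
    exact ENNReal.mul_ne_top (PMF.apply_ne_top _ _)
      (ne_top_of_le_ne_top ENNReal.one_ne_top (toOuterMeasure_le_one _ _))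

theorem mistakes_perm (r : Rule X) {S S' : List (X × Bool)} (h : S.Perm S') :
    mistakes r S = mistakes r S' := h.countP_eq _

/-- The algorithm sees its sample only as a multiset, so the differing examples of neighbouring
samples may be moved to the front. -/
theorem outProb_perm (η : ℝ) (k : ℕ) (Fs : List (X → Bool)) {S S' : List (X × Bool)}
    (h : S.Perm S') (R : Set (List (Rule X))) : outProb η k Fs S R = outProb η k Fs S' R := by
  induction k generalizing Fs S S' R with
  | zero => exact outProb_zero ..
  | succ k ih =>
    rcases eq_or_ne Fs [] with rfl | hF
    · exact outProb_nil ..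
    · rw [outProb_succ η k hF, outProb_succ η k hF]
      simp only [totalWeight, weight, mistakes_perm _ h]
      exact Finset.sum_congr rfl fun p _ => by rw [ih _ (h.filter _)]

/-! ### Privacy -/

theorem mistakes_cons (r : Rule X) (z : X × Bool) (S : List (X × Bool)) :
    mistakes r (z :: S) = mistakes r S + if r.1 z.1 && (z.2 != r.2) then 1 else 0 := by
  rw [mistakes, mistakes, List.countP_cons]

theorem weight_cons (η : ℝ) (r : Rule X) (z : X × Bool) (S : List (X × Bool)) :
    weight η (z :: S) r =
      (if r.1 z.1 && (z.2 != r.2) then Real.exp (-(η / 2)) else 1) * weight η S r := by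
  rw [weight, weight, mistakes_cons]
  split_ifs
  · rw [← Real.exp_add]
    push_cast
    ring_nf
  · simp

theorem weight_cons_le {η : ℝ} (hη : 0 ≤ η) (r : Rule X) (z : X × Bool) (S : List (X × Bool)) :
    weight η (z :: S) r ≤ weight η S r := by
  rw [weight_cons]
  refine mul_le_of_le_one_left (weight_pos _ _ _).le ?_
  split_ifs
  · exact Real.exp_le_one_iff.2 (by linarith)
  · exact le_rfl

theorem weight_le_exp_mul_weight_cons {η : ℝ} (hη : 0 ≤ η) (r : Rule X) (z : X × Bool)
    (S : List (X × Bool)) : weight η S r ≤ Real.exp (η / 2) * weight η (z :: S) r := by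
  rw [weight_cons, ← mul_assoc]
  refine le_mul_of_one_le_left (weight_pos _ _ _).le ?_
  split_ifs
  · rw [← Real.exp_add]; simp
  · rw [mul_one]; exact Real.one_le_exp (by linarith)

theorem totalWeight_cons_le {η : ℝ} (hη : 0 ≤ η) (Fs : List (X → Bool)) (z : X × Bool)
    (S : List (X × Bool)) : totalWeight η Fs (z :: S) ≤ totalWeight η Fs S :=
  Finset.sum_le_sum fun _ _ => weight_cons_le hη _ _ _

/-- Removing an example increases the probability of an event at most by the factor
`exp (η / 2)`. -/
theorem outProb_le_exp_mul_outProb_cons {η : ℝ} (hη : 0 ≤ η) (k : ℕ) (Fs : List (X → Bool))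
    (z : X × Bool) (S : List (X × Bool)) (R : Set (List (Rule X))) :
    outProb η k Fs S R ≤ Real.exp (η / 2) * outProb η k Fs (z :: S) R := by
  have he : 1 ≤ Real.exp (η / 2) := Real.one_le_exp (by linarith)
  induction k generalizing Fs S R with
  | zero =>
    rw [outProb_zero η Fs S (z :: S)]
    exact le_mul_of_one_le_left (outProb_nonneg ..) he
  | succ k ih =>
    rcases eq_or_ne Fs [] with rfl | hF
    · rw [outProb_nil η _ S (z :: S)]
      exact le_mul_of_one_le_left (outProb_nonneg ..) he
    · rw [outProb_succ η k hF, outProb_succ η k hF, Finset.mul_sum]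
      refine Finset.sum_le_sum fun p _ => ?_
      have hZ := totalWeight_pos η hF (z :: S)
      have hZ' := totalWeight_cons_le hη Fs z S
      have hw := weight_pos η (z :: S) (Fs.get p.1, p.2)
      rw [List.filter_cons]
      -- If the rule covers `z`, the remaining samples agree and the factor is paid here, in the
      -- weight. Otherwise the weight is unchanged, the normalizer only helps, and the factor is
      -- left to the later rounds.
      cases hc : Fs.get p.1 z.1 with
      | true =>
        simp only [Bool.not_true, Bool.false_eq_true, if_false]
        rw [← mul_assoc]
        refine mul_le_mul_of_nonneg_right ?_ (outProb_nonneg ..)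
        rw [← mul_div_assoc]
        exact div_le_div₀ (by positivity) (weight_le_exp_mul_weight_cons hη _ _ _) hZ hZ'
      | false =>
        simp only [Bool.not_false, if_true]
        rw [mul_left_comm]
        refine mul_le_mul ?_ (ih _ _ _) (outProb_nonneg ..) (by positivity)
        rw [weight_cons]
        simp only [hc, Bool.false_and, Bool.false_eq_true, if_false, one_mul]
        exact div_le_div_of_nonneg_left (weight_pos _ _ _).le hZ hZ'

/-- Adding an example increases the probability of an event at most by the factor
`exp ((exp (η / 2) - 1) * s)`, up to an additive `exp (-s)`. -/
theorem outProb_cons_le {η : ℝ} (hη : 0 ≤ η) (k : ℕ) (Fs : List (X → Bool))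
    (z : X × Bool) (S : List (X × Bool)) (R : Set (List (Rule X))) (s : ℝ) :
    outProb η k Fs (z :: S) R ≤
      Real.exp ((Real.exp (η / 2) - 1) * s) * outProb η k Fs S R + Real.exp (-s) := by
  set c := Real.exp (η / 2) - 1 with hc
  have hc0 : 0 ≤ c := sub_nonneg.2 (Real.one_le_exp (by linarith))
  -- The recursion replaces `s` by `s - b`, which may be negative; then the additive term alone
  -- exceeds any probability.
  have trivial_bound : ∀ (k : ℕ) (Fs : List (X → Bool)) (S S' : List (X × Bool))
      (R : Set (List (Rule X))) (s : ℝ), s ≤ 0 →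
      outProb η k Fs S' R ≤ Real.exp (c * s) * outProb η k Fs S R + Real.exp (-s) := by
    intro k Fs S S' R s hs
    have h1 := outProb_le_one η k Fs S' R
    have h2 : 1 ≤ Real.exp (-s) := Real.one_le_exp (by linarith)
    have h3 := mul_nonneg (Real.exp_pos (c * s)).le (outProb_nonneg η k Fs S R)
    linarith
  have same : ∀ (k : ℕ) (Fs : List (X → Bool)) (S : List (X × Bool))
      (R : Set (List (Rule X))) (s : ℝ),
      outProb η k Fs S R ≤ Real.exp (c * s) * outProb η k Fs S R + Real.exp (-s) := by
    intro k Fs S R s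
    rcases le_total s 0 with hs | hs
    · exact trivial_bound k Fs S S R s hs
    · have h1 : 1 ≤ Real.exp (c * s) := Real.one_le_exp (by positivity)
      have h2 := outProb_nonneg η k Fs S R
      have h3 := Real.exp_pos (-s)
      nlinarith
  induction k generalizing Fs S R s with
  | zero => rw [outProb_zero η Fs (z :: S) S]; exact same ..
  | succ k ih =>
    rcases eq_or_ne Fs [] with rfl | hF
    · rw [outProb_nil η _ (z :: S) S]; exact same ..
    rcases le_total s 0 with hs | hs
    · exact trivial_bound _ _ _ _ _ _ hs
    have hZ := totalWeight_pos η hF (z :: S)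
    have hZ0 := totalWeight_pos η hF S
    set Z := totalWeight η Fs (z :: S) with hZdef
    set Z₀ := totalWeight η Fs S with hZ₀def
    let bad : Fin Fs.length × Bool → Prop := fun p => (Fs.get p.1 z.1 && (z.2 != p.2)) = true
    let w : Fin Fs.length × Bool → ℝ := fun p => weight η (z :: S) (Fs.get p.1, p.2)
    let w₀ : Fin Fs.length × Bool → ℝ := fun p => weight η S (Fs.get p.1, p.2)
    have hw : ∀ p, 0 < w p := fun p => weight_pos _ _ _
    have hw₀ : ∀ p, 0 < w₀ p := fun p => weight_pos _ _ _
    have hbadw : ∀ p, bad p → w₀ p = (1 + c) * w p := by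
      intro p hp
      have : w p = Real.exp (-(η / 2)) * w₀ p := by
        simp only [w, w₀]
        rw [weight_cons, if_pos hp]
      rw [this, hc, ← mul_assoc, add_sub_cancel, ← Real.exp_add]
      simp
    have hgoodw : ∀ p, ¬ bad p → w₀ p = w p := by
      intro p hp
      simp only [w, w₀]
      rw [weight_cons, if_neg hp, one_mul]
    -- the probability of drawing a rule that mislabels the additional example
    set b : ℝ := ∑ p, if bad p then w p / Z else 0 with hb
    have hsumw : ∑ p, w p / Z = 1 := by
      rw [← Finset.sum_div]; exact div_self hZ.ne'
    have hgood : ∑ p, (if bad p then 0 else w p / Z) = 1 - b := by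
      rw [eq_sub_iff_add_eq, hb, ← Finset.sum_add_distrib, ← hsumw]
      exact Finset.sum_congr rfl fun p _ => by split_ifs <;> simp
    have hb0 : 0 ≤ b := Finset.sum_nonneg fun p _ => by
      split_ifs
      · exact div_nonneg (hw p).le hZ.le
      · exact le_rfl
    have hb1 : b ≤ 1 := by
      have : 0 ≤ 1 - b := hgood ▸ Finset.sum_nonneg fun p _ => by
        split_ifs
        · exact le_rfl
        · exact div_nonneg (hw p).le hZ.le
      linarith
    -- Deleting `z` multiplies exactly the bad weights by `1 + c`, and these form the fraction `b`
    -- of `Z`.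
    have hZZ : Z₀ = (1 + b * c) * Z := by
      have e1 : Z₀ = ∑ p, w₀ p := rfl
      have e2 : Z = ∑ p, w p := rfl
      have e3 : b * Z = ∑ p, if bad p then w p else 0 := by
        rw [hb, Finset.sum_mul]
        refine Finset.sum_congr rfl fun p _ => ?_
        split_ifs
        · exact div_mul_cancel₀ _ hZ.ne'
        · simp
      have : (1 + b * c) * Z = Z + c * (b * Z) := by ring
      rw [this, e3, e1]
      conv_rhs => rw [e2]
      rw [Finset.mul_sum, ← Finset.sum_add_distrib]
      refine Finset.sum_congr rfl fun p _ => ?_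
      by_cases hp : bad p
      · rw [hbadw p hp, if_pos hp]; ring
      · rw [hgoodw p hp, if_neg hp]; ring
    have hbc : 1 + b * c ≤ Real.exp (c * b) := by
      have := Real.add_one_le_exp (c * b); linarith
    have hbc0 : 0 < 1 + b * c := by positivity
    -- A bad rule removes `z`, and its probability is no smaller without `z`, so it costs nothing. A
    -- good rule costs the ratio of normalizers `1 + b * c ≤ exp (c * b)`, which is paid by
    -- continuing with budget `s - b`.
    have hterm : ∀ p : Fin Fs.length × Bool,
        w p / Z * outProb η k (Fs.eraseIdx p.1) ((z :: S).filter fun z => !Fs.get p.1 z.1)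
          {L | (Fs.get p.1, p.2) :: L ∈ R} ≤
        Real.exp (c * s) * (w₀ p / Z₀ * outProb η k (Fs.eraseIdx p.1)
          (S.filter fun z => !Fs.get p.1 z.1) {L | (Fs.get p.1, p.2) :: L ∈ R}) +
        (if bad p then 0 else w p / Z) * Real.exp (b - s) := by
      intro p
      by_cases hp : bad p
      · rw [if_pos hp, zero_mul, add_zero, ← mul_assoc]
        have hcov : Fs.get p.1 z.1 = true := by
          simp only [bad, Bool.and_eq_true] at hp; exact hp.1
        rw [List.filter_cons_of_neg (by rw [hcov]; decide)]
        refine mul_le_mul_of_nonneg_right ?_ (outProb_nonneg ..)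
        have h1 : w p / Z ≤ w₀ p / Z₀ := by
          rw [hbadw p hp, hZZ, mul_div_mul_comm]
          refine le_mul_of_one_le_left (div_nonneg (hw p).le hZ.le) ?_
          rw [one_le_div hbc0]
          nlinarith
        have h2 : 1 ≤ Real.exp (c * s) := Real.one_le_exp (by positivity)
        exact h1.trans (le_mul_of_one_le_left (div_nonneg (hw₀ p).le hZ0.le) h2)
      · rw [if_neg hp]
        set P' := outProb η k (Fs.eraseIdx p.1) ((z :: S).filter fun z => !Fs.get p.1 z.1)
          {L | (Fs.get p.1, p.2) :: L ∈ R} with hP'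
        set P₀ := outProb η k (Fs.eraseIdx p.1) (S.filter fun z => !Fs.get p.1 z.1)
          {L | (Fs.get p.1, p.2) :: L ∈ R} with hP₀
        have hrec : P' ≤ Real.exp (c * (s - b)) * P₀ + Real.exp (-(s - b)) := by
          rw [hP', List.filter_cons]
          split_ifs
          · exact ih ..
          · exact same ..
        have hP₀0 : 0 ≤ P₀ := outProb_nonneg ..
        have hwZ : w p / Z = (1 + b * c) * (w₀ p / Z₀) := by
          rw [hgoodw p hp, hZZ]
          field_simp
        have hwZ0 : 0 ≤ w₀ p / Z₀ := div_nonneg (hw₀ p).le hZ0.le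
        have hexp : (1 + b * c) * Real.exp (c * (s - b)) ≤ Real.exp (c * s) := by
          refine (mul_le_mul_of_nonneg_right hbc (Real.exp_pos _).le).trans_eq ?_
          rw [← Real.exp_add]; ring_nf
        calc w p / Z * P' ≤ w p / Z * (Real.exp (c * (s - b)) * P₀ + Real.exp (-(s - b))) :=
              mul_le_mul_of_nonneg_left hrec (div_nonneg (hw p).le hZ.le)
          _ = (1 + b * c) * Real.exp (c * (s - b)) * (w₀ p / Z₀ * P₀) +
                w p / Z * Real.exp (b - s) := by
              rw [neg_sub, mul_add, hwZ]; ring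
          _ ≤ _ := by
              gcongr
    rw [outProb_succ η k hF, outProb_succ η k hF, Finset.mul_sum]
    refine (Finset.sum_le_sum fun p _ => hterm p).trans ?_
    rw [Finset.sum_add_distrib, ← Finset.sum_mul, hgood]
    -- The additive errors `exp (b - s)` occur only on good rules, of total probability `1 - b ≤ exp
    -- (-b)`, which restores `exp (-s)`.
    have h1 : (1 - b) * Real.exp (b - s) ≤ Real.exp (-s) := by
      have : 1 - b ≤ Real.exp (-b) := by have := Real.add_one_le_exp (-b); linarith
      refine (mul_le_mul_of_nonneg_right this (Real.exp_pos _).le).trans_eq ?_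
      rw [← Real.exp_add]; ring_nf
    exact add_le_add le_rfl h1

theorem exists_perm_cons_of_neighbouring {Z : Type u} {n : ℕ} {S S' : Fin n → Z}
    (h : Neighbouring S S') :
    ∃ (z z' : Z) (l : List Z), (List.ofFn S).Perm (z :: l) ∧ (List.ofFn S').Perm (z' :: l) := by
  obtain ⟨i, hi⟩ := h
  have key : ∀ T : Fin n → Z, (List.ofFn T).Perm (T i :: (List.ofFn T).eraseIdx i) := by
    intro T
    have hlt : (i : ℕ) < (List.ofFn T).length := by simp
    have h1 := List.perm_insertIdx (T i) ((List.ofFn T).eraseIdx i) (i := i)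
      (by rw [List.length_eraseIdx_of_lt hlt]; omega)
    have h2 := List.insertIdx_eraseIdx_getElem hlt
    rw [List.getElem_ofFn, Fin.eta] at h2
    rwa [h2] at h1
  refine ⟨S i, S' i, (List.ofFn S).eraseIdx i, key S, ?_⟩
  have : (List.ofFn S).eraseIdx i = (List.ofFn S').eraseIdx i := by
    have : List.ofFn S' = (List.ofFn S).set i (S' i) := by
      refine List.ext_getElem (by simp) fun j h1 h2 => ?_
      rw [List.getElem_set, List.getElem_ofFn, List.getElem_ofFn]
      split_ifs with hij
      · exact congrArg S' (Fin.ext hij.symm)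
      · exact (hi _ fun h => hij (by rw [← h])).symm
    rw [this, List.eraseIdx_set_eq]
  rw [this]
  exact key S'

/-- Both samples are compared with their common part: `z` is dropped at budget `log (1 / δ)`, then
`z'` is inserted at a purely multiplicative cost, which leaves `δ` untouched. -/
theorem isDP_dpGreedyCover {η ε δ : ℝ} (hη : 0 ≤ η) (hδ : 0 < δ)
    (h : η / 2 + (Real.exp (η / 2) - 1) * Real.log (1 / δ) ≤ ε) (F : Finset (X → Bool)) (n : ℕ) :
    IsDP ε δ (fun S : Fin n → X × Bool => dpGreedyCover η F S) := by
  intro S S' hS R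
  obtain ⟨z, z', l, h1, h2⟩ := exists_perm_cons_of_neighbouring hS
  simp only [dpGreedyCover, timedDPGreedyCover]
  rw [← ofReal_outProb, ← ofReal_outProb, outProb_perm _ _ _ h1, outProb_perm _ _ _ h2,
    ← ENNReal.ofReal_mul (Real.exp_pos _).le,
    ← ENNReal.ofReal_add (mul_nonneg (Real.exp_pos _).le (outProb_nonneg ..)) hδ.le]
  refine ENNReal.ofReal_le_ofReal ?_
  have hA := outProb_cons_le hη (withTrue F).length (withTrue F) z l R (Real.log (1 / δ))
  have hB := outProb_le_exp_mul_outProb_cons hη (withTrue F).length (withTrue F) z' l R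
  have hδ' : Real.exp (-Real.log (1 / δ)) = δ := by
    rw [one_div, Real.log_inv, neg_neg, Real.exp_log hδ]
  rw [hδ'] at hA
  refine hA.trans (add_le_add ?_ le_rfl)
  refine (mul_le_mul_of_nonneg_left hB (Real.exp_pos _).le).trans ?_
  rw [← mul_assoc, ← Real.exp_add]
  refine mul_le_mul_of_nonneg_right (Real.exp_le_exp.2 ?_) (outProb_nonneg ..)
  linarith

/-! ### Accuracy -/

/-- The factor `exp (-η / 2)` for every example of `S` on which the hypothesis of `L` errs. -/
noncomputable def penalty (η : ℝ) (L : List (Rule X)) (S : List (X × Bool)) : ℝ :=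
  (S.map fun z => if hypothesis L z.1 = z.2 then 1 else Real.exp (-(η / 2))).prod

/-- The first rule alone decides the examples it covers, and the rest of the list decides the
others. Along a run the weights therefore multiply to the penalty of the final hypothesis. -/
theorem weight_mul_penalty (η : ℝ) (r : Rule X) (L : List (Rule X)) (S : List (X × Bool)) :
    weight η S r * penalty η L (S.filter fun z => !r.1 z.1) = penalty η (r :: L) S := by
  induction S with
  | nil => simp [weight, mistakes, penalty]
  | cons z S ih =>
    have hcons : penalty η (r :: L) (z :: S) =
        (if hypothesis (r :: L) z.1 = z.2 then 1 else Real.exp (-(η / 2))) *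
          penalty η (r :: L) S := by
      simp [penalty]
    rw [hcons, ← ih, weight_cons, List.filter_cons]
    cases h : r.1 z.1 with
    | true =>
      have h1 : hypothesis (r :: L) z.1 = r.2 := by simp [hypothesis, evalList, h]
      rw [h1]
      by_cases h2 : r.2 = z.2
      · simp [h2]
      · simp [h2, Ne.symm h2, mul_assoc]
    | false =>
      have h1 : hypothesis (r :: L) z.1 = hypothesis L z.1 := by
        simp [hypothesis, evalList, h]
      rw [h1]
      simp only [penalty, Bool.not_false, if_true, List.map_cons, List.prod_cons,
        Bool.false_and, Bool.false_eq_true, if_false, one_mul]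
      ring

/-- The examples of `S` are labelled by a decision list all of whose features that are not in `Fs`
are false on `S`. -/
def Realizable (Fs : List (X → Bool)) (S : List (X × Bool)) : Prop :=
  ∃ (L : List (Rule X)) (d : Bool), (∀ r ∈ L, r.1 ∈ Fs ∨ ∀ z ∈ S, r.1 z.1 = false) ∧
    ∀ z ∈ S, evalList L d z.1 = z.2

/-- The first rule whose feature is still available errs on no example, since all rules before it
are silent on `S`. If there is none, `S` has the constant label `d`, and any feature with label `d`
will do. -/
theorem Realizable.one_le_totalWeight {η : ℝ} {Fs : List (X → Bool)} {S : List (X × Bool)}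
    (h : Realizable Fs S) (hF : Fs ≠ []) : 1 ≤ totalWeight η Fs S := by
  obtain ⟨L, d, hL, hd⟩ := h
  have key : ∃ f ∈ Fs, ∃ b, mistakes (f, b) S = 0 := by
    induction L with
    | nil =>
      obtain ⟨f, hf⟩ := List.exists_mem_of_ne_nil Fs hF
      refine ⟨f, hf, d, List.countP_eq_zero.2 fun z hz => ?_⟩
      simp [← hd z hz, evalList]
    | cons r L ih =>
      rcases hL r (by simp) with hr | hr
      · refine ⟨r.1, hr, r.2, List.countP_eq_zero.2 fun z hz => ?_⟩
        have := hd z hz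
        simp only [evalList] at this
        by_cases h : r.1 z.1 = true
        · rw [if_pos h] at this; simp [this]
        · simp [h]
      · refine ih (fun s hs => hL s (by simp [hs])) fun z hz => ?_
        have := hd z hz
        simpa [evalList, hr z hz] using this
  obtain ⟨f, hf, b, h0⟩ := key
  obtain ⟨i, rfl⟩ := List.get_of_mem hf
  have h1 : weight η S (Fs.get i, b) = 1 := by rw [weight, h0]; simp
  have h2 := Finset.single_le_sum (s := Finset.univ)
    (f := fun p : Fin Fs.length × Bool => weight η S (Fs.get p.1, p.2))
    (fun p _ => (weight_pos _ _ _).le) (Finset.mem_univ (i, b))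
  exact h1.symm.le.trans h2

theorem eq_get_or_mem_eraseIdx {A : Type v} {l : List A} (i : Fin l.length) {a : A} (h : a ∈ l) :
    a = l.get i ∨ a ∈ l.eraseIdx i := by
  obtain ⟨j, rfl⟩ := List.get_of_mem h
  by_cases hij : j = i
  · exact Or.inl (by rw [hij])
  · exact Or.inr (List.mem_eraseIdx_iff_getElem.2
      ⟨j, j.2, fun h => hij (Fin.ext h), rfl⟩)

/-- The same list remains a witness: the feature just removed is false on every surviving example.
`Realizable` tolerates such dead features for this reason. -/
theorem Realizable.step {Fs : List (X → Bool)} {S : List (X × Bool)}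
    (h : Realizable Fs S) (i : Fin Fs.length) :
    Realizable (Fs.eraseIdx i) (S.filter fun z => !Fs.get i z.1) := by
  obtain ⟨L, d, hL, hd⟩ := h
  refine ⟨L, d, fun r hr => ?_, fun z hz => hd z (List.mem_of_mem_filter hz)⟩
  rcases hL r hr with h | h
  · rcases eq_get_or_mem_eraseIdx i h with h | h
    · right
      intro z hz
      rw [h]
      simpa using (List.mem_filter.1 hz).2
    · exact Or.inl h
  · exact Or.inr fun z hz => h z (List.mem_of_mem_filter hz)

/-- The runs of the greedy cover loop until all features are used, in a family that does not
depend on the sample. On a realizable sample the probability of each run is at most its penalty. -/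
theorem exists_runs (k : ℕ) (Fs : List (X → Bool)) (hk : Fs.length = k) :
    ∃ (ι : Type) (_ : Fintype ι) (ℓ : ι → List (Rule X)),
      Fintype.card ι = 2 ^ k * k.factorial ∧ (∀ i, ∀ r ∈ ℓ i, r.1 ∈ Fs) ∧
      ∀ (η : ℝ) (S : List (X × Bool)), (S = [] ∨ (fun _ => true) ∈ Fs) → Realizable Fs S →
        ∀ R : Set (List (Rule X)),
          outProb η k Fs S R ≤ ∑ i, R.indicator (fun L => penalty η L S) (ℓ i) := by
  classical
  induction k generalizing Fs with
  | zero =>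
    obtain rfl : Fs = [] := List.length_eq_zero_iff.1 hk
    refine ⟨Unit, inferInstance, fun _ => [], by simp, by simp, fun η S hS _ R => ?_⟩
    -- Using the constant true feature has emptied the sample, so the default value of `hypothesis`
    -- causes no error.
    obtain rfl : S = [] := by simpa using hS
    by_cases hR : [] ∈ R
    · simpa [hR, penalty] using outProb_le_one η 0 [] [] R
    · simp [hR, outProb, greedyCover]
  | succ k ih =>
    have hF : Fs ≠ [] := by rintro rfl; simp at hk
    choose ι hι ℓ hcard hmem hprob using fun p : Fin Fs.length × Bool =>
      ih (Fs.eraseIdx p.1) (by rw [List.length_eraseIdx_of_lt p.1.2, hk]; rfl)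
    refine ⟨Σ p, ι p, inferInstance, fun i => (Fs.get i.1.1, i.1.2) :: ℓ i.1 i.2, ?_, ?_, ?_⟩
    · rw [Fintype.card_sigma, Finset.sum_congr rfl fun p _ => hcard p]
      simp [hk, Nat.factorial_succ, pow_succ]
      ring
    · rintro ⟨p, i⟩ r hr
      rcases List.mem_cons.1 hr with rfl | hr
      · exact List.get_mem _ _
      · exact List.mem_of_mem_eraseIdx (hmem p i r hr)
    · intro η S hS hreal R
      rw [outProb_succ η k hF, Fintype.sum_sigma]
      refine Finset.sum_le_sum fun p _ => ?_
      have hS' : (S.filter fun z => !Fs.get p.1 z.1) = [] ∨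
          (fun _ => true) ∈ Fs.eraseIdx p.1 := by
        rcases hS with rfl | hS
        · simp
        · rcases eq_get_or_mem_eraseIdx p.1 hS with h | h
          · left; rw [← h]; simp
          · exact Or.inr h
      have h1 := hprob p η _ hS' (hreal.step p.1) {L | (Fs.get p.1, p.2) :: L ∈ R}
      have h2 : weight η S (Fs.get p.1, p.2) / totalWeight η Fs S ≤
          weight η S (Fs.get p.1, p.2) :=
        div_le_self (weight_pos _ _ _).le (hreal.one_le_totalWeight hF)
      refine (mul_le_mul h2 h1 (outProb_nonneg ..) (weight_pos _ _ _).le).trans_eq ?_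
      rw [Finset.mul_sum]
      refine Finset.sum_congr rfl fun i _ => ?_
      by_cases hR : (Fs.get p.1, p.2) :: ℓ p i ∈ R
      · rw [Set.indicator_of_mem hR, Set.indicator_of_mem (by exact hR),
          ← weight_mul_penalty]
      · rw [Set.indicator_of_notMem hR, Set.indicator_of_notMem (by exact hR), mul_zero]

theorem measurable_evalList [MeasurableSpace X] {L : List (Rule X)} {d : Bool}
    (hL : ∀ r ∈ L, Measurable r.1) : Measurable (evalList L d) := by
  induction L with
  | nil => exact measurable_const
  | cons r L ih =>
    have hr : MeasurableSet {x | r.1 x = true} :=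
      hL r (by simp) (measurableSet_singleton true)
    exact Measurable.ite hr measurable_const (ih fun s hs => hL s (by simp [hs]))

theorem lintegral_pi_prod_comp [MeasurableSpace X] (D : Measure X) [IsProbabilityMeasure D]
    (n : ℕ) {g : X → ℝ≥0∞} (hg : Measurable g) :
    ∫⁻ xs : Fin n → X, ∏ i, g (xs i) ∂(Measure.pi fun _ => D) = (∫⁻ x, g x ∂D) ^ n := by
  have h := lintegral_prod_eq_prod_lintegral_of_indepFun (μ := Measure.pi fun _ : Fin n => D)
    Finset.univ (fun i xs => g (xs i)) (iIndepFun_pi fun _ => hg.aemeasurable)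
    fun i => hg.comp (measurable_pi_apply i)
  rw [h]
  have : ∀ i : Fin n, ∫⁻ xs : Fin n → X, g (xs i) ∂(Measure.pi fun _ => D) = ∫⁻ x, g x ∂D :=
    fun i => (measurePreserving_eval (fun _ : Fin n => D) i).lintegral_comp hg
  simp [this]

/-- The expected penalty of one example under a hypothesis of error at least `a`. -/
theorem lintegral_penalty_le [MeasurableSpace X] (D : Measure X) [IsProbabilityMeasure D]
    {c h : X → Bool} (hc : Measurable c) (hh : Measurable h) {a t : ℝ} (ha : 0 ≤ a) (ht0 : 0 ≤ t)
    (ht1 : t ≤ 1) (herr : ENNReal.ofReal a ≤ err D c h) :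
    ∫⁻ x, ENNReal.ofReal (if h x = c x then 1 else t) ∂D ≤
      ENNReal.ofReal (Real.exp (-(a * (1 - t)))) := by
  have hs : MeasurableSet {x | c x ≠ h x} := (measurableSet_eq_fun hc hh).compl
  have hg : Measurable fun x => ENNReal.ofReal (if h x = c x then 1 else t) :=
    (Measurable.ite (measurableSet_eq_fun hh hc) measurable_const measurable_const).ennreal_ofReal
  -- The expected penalty is `1 - (1 - t) * err`, written as a sum because subtraction in `ℝ≥0∞`
  -- truncates; `1 - y ≤ exp (-y)` finishes.
  have h1 : ∫⁻ x, ENNReal.ofReal (if h x = c x then 1 else t) ∂D +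
      ENNReal.ofReal (1 - t) * err D c h = 1 := by
    rw [err, ← lintegral_indicator_const hs, ← lintegral_add_left hg]
    have : ∀ x, ENNReal.ofReal (if h x = c x then 1 else t) +
        {x | c x ≠ h x}.indicator (fun _ => ENNReal.ofReal (1 - t)) x = 1 := by
      intro x
      by_cases hx : h x = c x
      · rw [Set.indicator_of_notMem (by simp [hx])]; simp [hx]
      · rw [Set.indicator_of_mem (by exact fun h => hx h.symm), if_neg hx,
          ← ENNReal.ofReal_add ht0 (by linarith)]
        simp
    simp [this]
  have h2 : ENNReal.ofReal (a * (1 - t)) ≤ ENNReal.ofReal (1 - t) * err D c h := by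
    rw [mul_comm, ENNReal.ofReal_mul (by linarith)]
    exact mul_le_mul_right herr _
  have h3 : ∫⁻ x, ENNReal.ofReal (if h x = c x then 1 else t) ∂D ≤
      1 - ENNReal.ofReal (a * (1 - t)) := by
    refine ENNReal.le_sub_of_add_le_right ENNReal.ofReal_ne_top ?_
    rw [← h1]
    exact add_le_add le_rfl h2
  refine h3.trans ?_
  rw [← ENNReal.ofReal_one, ← ENNReal.ofReal_sub _ (mul_nonneg ha (by linarith))]
  refine ENNReal.ofReal_le_ofReal ?_
  have := Real.add_one_le_exp (-(a * (1 - t)))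
  linarith

theorem realizable_withTrue {F : Finset (X → Bool)} {c : X → Bool} (hc : c ∈ decisionLists F)
    {n : ℕ} (xs : Fin n → X) : Realizable (withTrue F) (List.ofFn fun i => (xs i, c (xs i))) := by
  classical
  obtain ⟨L, d, hL, rfl⟩ := hc
  refine ⟨L, d, fun r hr => Or.inl ?_, fun z hz => ?_⟩
  · simp [withTrue, hL r hr]
  · obtain ⟨i, rfl⟩ := (List.mem_ofFn' _ _).1 hz
    rfl

theorem isPACLearner_of_card_mul_exp_le [MeasurableSpace X] {F : Finset (X → Bool)}
    (hF : ∀ f ∈ F, Measurable f) {η α β : ℝ} {n : ℕ} (hη : 0 ≤ η) (hα : 0 ≤ α)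
    (h : (2 ^ (F.card + 1) * (F.card + 1).factorial : ℕ) *
      Real.exp (-(α * (1 - Real.exp (-(η / 2))))) ^ n ≤ β) :
    IsPACLearner (decisionLists F) α β hypothesis
      (fun S : Fin n → X × Bool => dpGreedyCover η F S) := by
  classical
  intro D _ c hc
  obtain ⟨ι, hι, ℓ, hcard, hmem, hprob⟩ := exists_runs _ (withTrue F) rfl
  set t := Real.exp (-(η / 2)) with ht
  have ht0 : 0 ≤ t := (Real.exp_pos _).le
  have ht1 : t ≤ 1 := Real.exp_le_one_iff.2 (by linarith)
  set B : Set (List (Rule X)) := {L | err D c (hypothesis L) ≤ ENNReal.ofReal α}ᶜ with hB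
  have hmeasT : ∀ f ∈ withTrue F, Measurable f := by
    intro f hf
    rw [withTrue, Finset.mem_toList, Finset.mem_insert] at hf
    rcases hf with rfl | hf
    · exact measurable_const
    · exact hF f hf
  have hcm : Measurable c := by
    obtain ⟨L, d, hL, rfl⟩ := hc
    exact measurable_evalList fun r hr => hF _ (hL r hr)
  have hℓm : ∀ i, Measurable (hypothesis (ℓ i)) := fun i =>
    measurable_evalList fun r hr => hmeasT _ (hmem i r hr)
  let g : ι → X → ℝ≥0∞ := fun i x => ENNReal.ofReal (if hypothesis (ℓ i) x = c x then 1 else t)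
  have hg : ∀ i, Measurable (g i) := fun i =>
    (Measurable.ite (measurableSet_eq_fun (hℓm i) hcm) measurable_const
      measurable_const).ennreal_ofReal
  -- `G` bounds the probability of a bad output. It is measurable because the runs do not depend on
  -- the sample, so measurability of the output probabilities in `xs` is not needed.
  let G : (Fin n → X) → ℝ≥0∞ := fun xs =>
    ∑ i, if ℓ i ∈ B then ∏ j, g i (xs j) else 0
  have hprodm : ∀ i, Measurable fun xs : Fin n → X => ∏ j, g i (xs j) := fun i =>
    Finset.measurable_fun_prod _ fun j _ => (hg i).comp (measurable_pi_apply j)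
  have htermm : ∀ i, Measurable fun xs : Fin n → X =>
      if ℓ i ∈ B then ∏ j, g i (xs j) else 0 := by
    intro i
    by_cases hi : ℓ i ∈ B
    · simpa [hi] using hprodm i
    · simp [hi]
  have hGm : Measurable G := Finset.measurable_fun_sum _ fun i _ => htermm i
  have hGint : ∫⁻ xs, G xs ∂(Measure.pi fun _ : Fin n => D) ≤ ENNReal.ofReal β := by
    have h1 : ∀ i, ∫⁻ xs : Fin n → X, (if ℓ i ∈ B then ∏ j, g i (xs j) else 0)
        ∂(Measure.pi fun _ : Fin n => D) ≤
        ENNReal.ofReal (Real.exp (-(α * (1 - t))) ^ n) := by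
      intro i
      by_cases hi : ℓ i ∈ B
      · simp only [hi, if_true]
        rw [lintegral_pi_prod_comp D n (hg i), ENNReal.ofReal_pow (Real.exp_pos _).le]
        exact pow_le_pow_left' (lintegral_penalty_le D hcm (hℓm i) hα ht0 ht1 (le_of_lt <| not_le.1 <| by exact hi)) n
      · simp [hi]
    have hcard' : (Fintype.card ι : ℝ) ≤ (2 ^ (F.card + 1) * (F.card + 1).factorial : ℕ) := by
      rw [hcard]
      exact_mod_cast Nat.mul_le_mul (Nat.pow_le_pow_right (by norm_num) (length_withTrue_le F))
        (Nat.factorial_le (length_withTrue_le F))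
    calc ∫⁻ xs, G xs ∂(Measure.pi fun _ : Fin n => D)
        = ∑ i, ∫⁻ xs : Fin n → X, (if ℓ i ∈ B then ∏ j, g i (xs j) else 0)
            ∂(Measure.pi fun _ : Fin n => D) := lintegral_finsetSum _ fun i _ => htermm i
      _ ≤ ∑ _i : ι, ENNReal.ofReal (Real.exp (-(α * (1 - t))) ^ n) :=
          Finset.sum_le_sum fun i _ => h1 i
      _ = ENNReal.ofReal (Fintype.card ι * Real.exp (-(α * (1 - t))) ^ n) := by
          rw [Finset.sum_const, nsmul_eq_mul, ENNReal.ofReal_mul (Nat.cast_nonneg _),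
            ENNReal.ofReal_natCast, Finset.card_univ]
      _ ≤ ENNReal.ofReal β := ENNReal.ofReal_le_ofReal
          ((mul_le_mul_of_nonneg_right hcard' (by positivity)).trans h)
  have hgood : ∀ xs : Fin n → X, 1 - G xs ≤
      (dpGreedyCover η F fun i => (xs i, c (xs i))).toOuterMeasure
        {L | err D c (hypothesis L) ≤ ENNReal.ofReal α} := by
    intro xs
    set p := dpGreedyCover η F fun i => (xs i, c (xs i)) with hp
    have hbad : p.toOuterMeasure B ≤ G xs := by
      have h1 := hprob η (List.ofFn fun i => (xs i, c (xs i)))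
        (Or.inr (by simp [withTrue])) (realizable_withTrue hc xs) B
      rw [hp, dpGreedyCover, timedDPGreedyCover, ← ofReal_outProb]
      refine (ENNReal.ofReal_le_ofReal h1).trans_eq ?_
      rw [ENNReal.ofReal_sum_of_nonneg]
      · refine Finset.sum_congr rfl fun i _ => ?_
        by_cases hi : ℓ i ∈ B
        · rw [Set.indicator_of_mem hi, if_pos hi, penalty, List.map_ofFn, List.prod_ofFn,
            ENNReal.ofReal_prod_of_nonneg]
          · rfl
          · intro j _
            simp only [Function.comp]
            split_ifs
            · exact zero_le_one
            · exact ht0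
        · simp [hi]
      · intro i _
        refine Set.indicator_nonneg (fun L _ => List.prod_nonneg fun a ha => ?_) _
        obtain ⟨z, -, rfl⟩ := List.mem_map.1 ha
        split_ifs
        · exact zero_le_one
        · exact ht0
    have htot : (1 : ℝ≥0∞) ≤ p.toOuterMeasure Bᶜ + p.toOuterMeasure B := by
      refine le_trans ?_ (measure_union_le _ _)
      rw [Set.compl_union_self]
      exact ((PMF.toOuterMeasure_apply_eq_one_iff p _).2 (Set.subset_univ _)).ge
    rw [hB, compl_compl] at htot
    exact tsub_le_iff_right.2 (htot.trans (add_le_add le_rfl hbad))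
  calc 1 - ENNReal.ofReal β
      ≤ ∫⁻ _xs : Fin n → X, 1 ∂(Measure.pi fun _ : Fin n => D) -
        ∫⁻ xs, G xs ∂(Measure.pi fun _ : Fin n => D) := by
        rw [lintegral_one, measure_univ]
        exact tsub_le_tsub_left hGint 1
    _ ≤ ∫⁻ xs : Fin n → X, 1 - G xs ∂(Measure.pi fun _ : Fin n => D) :=
        lintegral_sub_le _ _ hGm
    _ ≤ _ := lintegral_mono hgood

/-! ### The choice of the parameter -/

theorem two_pow_succ_mul_factorial_le {M : ℕ} (hM : 1 ≤ M) :
    2 ^ (M + 1) * (M + 1).factorial ≤ (2 * M) ^ (3 * M) := by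
  have h1 : (M + 1).factorial ≤ (2 * M) ^ M := by
    have h : ∀ k, k ≤ M → (k + 1).factorial ≤ (2 * M) ^ k := by
      intro k
      induction k with
      | zero => simp
      | succ k ih =>
        intro hk
        rw [Nat.factorial_succ, pow_succ, mul_comm]
        exact Nat.mul_le_mul (ih (by omega)) (by omega)
    exact h M le_rfl
  have h2 : 2 ^ (M + 1) ≤ (2 * M) ^ (2 * M) :=
    (Nat.pow_le_pow_right (by norm_num) (by omega)).trans (Nat.pow_le_pow_left (by omega) _)
  calc 2 ^ (M + 1) * (M + 1).factorial ≤ (2 * M) ^ (2 * M) * (2 * M) ^ M := Nat.mul_le_mul h2 h1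
    _ = (2 * M) ^ (3 * M) := by rw [← pow_add]; congr 1; omega

/-- The convex function `5 ^ s` lies below its chord on `[0, 1]`. Base 5 makes the slope equal to
the 4 in `4 * log (1 / δ) + 3`, while the chord of `5 ^ (-s)` has slope `-4/5`, steep enough for the
union bound, which needs `3/4`. -/
theorem exp_mul_log_five_le {s : ℝ} (h0 : 0 ≤ s) (h1 : s ≤ 1) :
    Real.exp (s * Real.log 5) ≤ 1 + 4 * s := by
  have h := rpow_one_add_le_one_add_mul_self (s := 4) (by norm_num) h0 h1
  rw [Real.rpow_def_of_pos (by norm_num), mul_comm] at h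
  norm_num at h
  linarith

theorem exp_neg_mul_log_five_le {s : ℝ} (h0 : 0 ≤ s) (h1 : s ≤ 1) :
    Real.exp (-(s * Real.log 5)) ≤ 1 - 4 / 5 * s := by
  have h := rpow_one_add_le_one_add_mul_self (s := -(4 / 5)) (by norm_num) h0 h1
  rw [Real.rpow_def_of_pos (by norm_num), show (1 + -(4 / 5) : ℝ) = 5⁻¹ by norm_num,
    Real.log_inv, neg_mul, mul_comm] at h
  linarith

theorem log_five_le_three : Real.log 5 ≤ 3 := by
  have := Real.log_le_sub_one_of_pos (show (0 : ℝ) < 5 / 2 by norm_num)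
  have h2 := Real.log_two_lt_d9
  have : Real.log 5 = Real.log (5 / 2) + Real.log 2 := by
    rw [← Real.log_mul (by norm_num) (by norm_num)]; norm_num
  linarith

theorem card_mul_exp_le_of_sampleBound_le {d M n : ℕ} {α β ε δ t : ℝ} (hM : 1 ≤ M) (hα : 0 < α)
    (hβ : 0 < β) (hβ1 : β < 1) (hε : 0 < ε) (hδ : 0 < δ) (hδ1 : δ < 1)
    (ht : t ≤ 1 - 4 / 5 * (ε / (4 * Real.log (1 / δ) + 3)))
    (hn : sampleBound d M α β ε δ ≤ n) :
    (2 ^ (M + 1) * (M + 1).factorial : ℕ) * Real.exp (-(α * (1 - t))) ^ n ≤ β := by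
  have hL : 0 ≤ Real.log (1 / δ) := Real.log_nonneg (by rw [le_div_iff₀ hδ]; linarith)
  set L := Real.log (1 / δ) with hLdef
  have hM' : (1 : ℝ) ≤ M := by exact_mod_cast hM
  have hlogM : 0 ≤ Real.log (2 * M) := Real.log_nonneg (by linarith)
  have hlogβ : Real.log β ≤ 0 := Real.log_nonpos hβ.le hβ1.le
  have hlog : Real.log (2 * M / Real.sqrt β) = Real.log (2 * M) - Real.log β / 2 := by
    rw [Real.log_div (by positivity) (Real.sqrt_pos.2 hβ).ne', Real.log_sqrt hβ.le]
  have h2 := (le_max_right _ _).trans hn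
  rw [div_le_iff₀ (by positivity), hlog] at h2
  -- `8 * (2 * L + 3 / 2) = 4 * (4 * L + 3)` cancels the denominator of `ε / (4 * L + 3)`.
  have h3 : 4 * M * (Real.log (2 * M) - Real.log β / 2) ≤ n * α * (ε / (4 * L + 3)) := by
    rw [← mul_div_assoc, le_div_iff₀ (by positivity)]
    linarith
  have h4 : 16 / 5 * M * (Real.log (2 * M) - Real.log β / 2) ≤ n * (α * (1 - t)) := by
    have : n * α * (4 / 5 * (ε / (4 * L + 3))) ≤ n * α * (1 - t) :=
      mul_le_mul_of_nonneg_left (by linarith) (by positivity)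
    linarith
  have h5 : ((2 ^ (M + 1) * (M + 1).factorial : ℕ) : ℝ) ≤
      Real.exp (3 * M * Real.log (2 * M)) := by
    have : ((2 ^ (M + 1) * (M + 1).factorial : ℕ) : ℝ) ≤ ((2 * M : ℝ)) ^ (3 * M) := by
      exact_mod_cast two_pow_succ_mul_factorial_le hM
    refine this.trans_eq ?_
    rw [← Real.exp_log (show (0 : ℝ) < (2 * M) ^ (3 * M) by positivity), Real.log_pow]
    push_cast
    rfl
  rw [← Real.exp_nat_mul]
  calc _ ≤ Real.exp (3 * M * Real.log (2 * M)) * Real.exp (n * -(α * (1 - t))) :=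
        mul_le_mul_of_nonneg_right h5 (Real.exp_pos _).le
    _ ≤ Real.exp (Real.log β) := by
        rw [← Real.exp_add]
        refine Real.exp_le_exp.2 ?_
        -- The exponent `16/5` beats the `3` from counting runs, and the coefficient `8/5 * M` of
        -- `-log β` exceeds `1`.
        have h6 : 0 ≤ M * Real.log (2 * M) := by positivity
        have h7 : 0 ≤ (M - 1 : ℝ) * -Real.log β := mul_nonneg (by linarith) (by linarith)
        nlinarith
    _ = β := Real.exp_log hβ

end DecisionListLearning

open DecisionListLearning in
theorem mainTheorem1 :
    ∃ p : Polynomial ℕ, ∀ ε δ : ℝ, 0 < ε → 0 < δ → δ < 1 → ε ≤ 4 * Real.log (1 / δ) + 3 →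
      ∃ η : ℝ, 0 < η ∧
        -- privacy, accuracy and running time on samples of arbitrary size
        (∀ (X : Type u) [MeasurableSpace X] (F : Finset (X → Bool)), F.Nonempty →
          (∀ f ∈ F, Measurable f) → ∀ n : ℕ,
            IsDP ε δ (fun S : Fin n → X × Bool => dpGreedyCover η F S) ∧
            (∀ S : Fin n → X × Bool, RunsWithin η F S (p.eval F.card * (n + 1))) ∧
            (∀ α β : ℝ, 0 < α → α < 1 → 0 < β → β < 1 →
              sampleBound (vcDim (decisionLists F)).toNat F.card α β ε δ ≤ n →
              IsPACLearner (decisionLists F) α β hypothesis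
                (fun S : Fin n → X × Bool => dpGreedyCover η F S))) ∧
        -- running time polynomial in the number of features alone, at the stated sample size
        (∀ α β : ℝ, 0 < α → α < 1 → 0 < β → β < 1 →
          ∃ q : Polynomial ℕ, ∀ (X : Type u) (F : Finset (X → Bool)), F.Nonempty →
            ∀ S : Fin ⌈sampleBound (vcDim (decisionLists F)).toNat F.card α β ε δ⌉₊ → X × Bool,
              RunsWithin η F S (q.eval F.card)) := by
  refine ⟨1 + 13 * (Polynomial.X + 1) * (Polynomial.X + 2), fun ε δ hε hδ hδ1 hεδ => ?_⟩
  have hp : ∀ m : ℕ, (1 + 13 * (Polynomial.X + 1) * (Polynomial.X + 2) : Polynomial ℕ).eval m =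
      1 + 13 * (m + 1) * (m + 2) := by
    intro m
    simp
  have hL : 0 ≤ Real.log (1 / δ) := Real.log_nonneg (by rw [le_div_iff₀ hδ]; linarith)
  set s := ε / (4 * Real.log (1 / δ) + 3) with hs
  have hs0 : 0 < s := by positivity
  -- The assumed upper bound on `ε` is exactly what the chord bounds on `[0, 1]` need.
  have hs1 : s ≤ 1 := (div_le_one (by positivity)).2 hεδ
  have hlog5 : 0 < Real.log 5 := Real.log_pos (by norm_num)
  have hhalf : 2 * (s * Real.log 5) / 2 = s * Real.log 5 := by ring
  refine ⟨2 * (s * Real.log 5), by positivity, ?_, ?_⟩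
  · intro X _ F hF hmeas n
    refine ⟨isDP_dpGreedyCover (by positivity) hδ ?_ F n,
      fun S => runsWithin_of_le _ F S (by rw [hp]), fun α β hα _ hβ hβ1 hn => ?_⟩
    -- The budget `ε = s * (4 * log (1 / δ) + 3)` splits: `3 * s` covers `η / 2 = s * log 5`, and
    -- the rest covers the cost of adding an example.
    · rw [hhalf]
      have h1 : Real.exp (s * Real.log 5) - 1 ≤ 4 * s := by
        linarith [exp_mul_log_five_le hs0.le hs1]
      have h2 := mul_le_mul_of_nonneg_right h1 hL
      have h3 := mul_le_mul_of_nonneg_left log_five_le_three hs0.le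
      have h4 : s * (4 * Real.log (1 / δ) + 3) = ε := div_mul_cancel₀ _ (by positivity)
      linarith
    · refine isPACLearner_of_card_mul_exp_le hmeas (by positivity) hα.le ?_
      rw [hhalf]
      exact card_mul_exp_le_of_sampleBound_le (Finset.card_pos.2 hF) hα hβ hβ1 hε hδ hδ1
        (exp_neg_mul_log_five_le hs0.le hs1) hn
  · intro α β hα hα1 hβ hβ1
    obtain ⟨K, hK⟩ := exists_ceil_sampleBound_le α β ε δ hα hα1 hβ hβ1 hε hδ hδ1
    refine ⟨(1 + 13 * (Polynomial.X + 1) * (Polynomial.X + 2)) *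
      (Polynomial.C K * (Polynomial.X + 1) ^ 2 + 1), fun X F _ S => runsWithin_of_le _ F S ?_⟩
    rw [Polynomial.eval_mul, hp]
    refine Nat.mul_le_mul_left _ ?_
    simpa using hK _ F.card (toNat_vcDim_decisionLists_le F)
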